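/- Let $A\in\mathbb{R}_{+}^{M\times N}$, $\alpha,\beta\ge 0$, $\sigma>0$ and $c\ge 0$, and consider the problem of minimizing $$J(B,S,C)=\tfrac12\|A-BSC\|_F^2+\tfrac{c\alpha}{2}\|CC^T-I\|_F^2+\tfrac{c\beta}{2}\|B^TB-I\|_F^2$$ over entrywise nonnegative $B\in\mathbb{R}^{M\times P}$, $S\in\mathbb{R}^{P\times Q}$, $C\in\mathbb{R}^{Q\times N}$. (The case $c=1$ is the usual penalized bi-orthogonal nonnegative matrix tri-factorization problem; in the case $c=\tfrac12$ the penalty parts of the gradients are $\beta BB^TB-\beta B$ and $\alpha CC^TC-\alpha C$.) Write $\nabla_BJ,\nabla_SJ,\nabla_CJ$ for the matrices of partial derivatives. Given entrywise nonnegative $B^{(0)},S^{(0)},C^{(0)}$ and sequences $\delta_B^{(k)},\delta_C^{(k)},\delta_S^{(k)}>0$, the additive-update algorithm computes, for $k=0,1,2,\dots$ and in this order, $$b_{mp}^{(k+1)}=b_{mp}^{(k)}-\frac{\bar b_{mp}^{(k)}\,\nabla_BJ(B^{(k)},S^{(k)},C^{(k)})_{mp}}{\big(\bar B^{(k)}S^{(k)}C^{(k)}C^{(k)T}S^{(k)T}+\beta\bar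 B^{(k)}\bar B^{(k)T}\bar B^{(k)}\big)_{mp}+\delta_B^{(k)}},$$ $$c_{qn}^{(k+1)}=c_{qn}^{(k)}-\frac{\bar c_{qn}^{(k)}\,\nabla_CJ(B^{(k+1)},S^{(k)},C^{(k)})_{qn}}{\big(S^{(k)T}B^{(k+1)T}B^{(k+1)}S^{(k)}\bar C^{(k)}+\alpha\bar C^{(k)}\bar C^{(k)T}\bar C^{(k)}\big)_{qn}+\delta_C^{(k)}},$$ $$s_{pq}^{(k+1)}=s_{pq}^{(k)}-\frac{\bar s_{pq}^{(k)}\,\nabla_SJ(B^{(k+1)},S^{(k)},C^{(k+1)})_{pq}}{\big(B^{(k+1)T}B^{(k+1)}\bar S^{(k)}C^{(k+1)}C^{(k+1)T}\big)_{pq}+\delta_S^{(k)}},$$ where $\bar x=x$ if the gradient entry occurring in the same update is $\ge 0$ and $\bar x=\max(x,\sigma)$ otherwise. Then for every $R$ there is $\delta_0>0$ (depending only on the dimensions and $A,\alpha,\beta,c,\sigma,R$) such that the following holds. If the sequences $\delta_B^{(k)},\delta_C^{(k)},\delta_S^{(k)}$ are bounded and all their terms are $\ge\delta_0$, and if all entries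 of all iterates $B^{(k)},S^{(k)},C^{(k)}$ are at most $R$ in absolute value, then every limit point $(B^*,S^*,C^*)$ of the sequence $(B^{(k)},S^{(k)},C^{(k)})$ is a stationary point, i.e. it satisfies the Karush–Kuhn–Tucker conditions: $X^*\ge 0$, $\nabla_XJ(B^*,S^*,C^*)\ge 0$ and $\nabla_XJ(B^*,S^*,C^*)\odot X^*=0$ (entrywise) for $X=B,S,C$. -/

import Mathlib

namespace BNMtF

open scoped Matrix

noncomputable section

/-- The squared Frobenius norm of a real matrix. -/
def frobSq {m n : ℕ} (X : Matrix (Fin m) (Fin n) ℝ) : ℝ := ∑ i, ∑ j, X i j ^ 2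

/-- Entrywise nonnegativity. -/
def Nonneg {m n : ℕ} (X : Matrix (Fin m) (Fin n) ℝ) : Prop := ∀ i j, 0 ≤ X i j

variable {M N P Q : ℕ}

/-- The penalized objective
`J(B, S, C) = ½‖A - BSC‖² + (cα/2)‖CCᵀ - I‖² + (cβ/2)‖BᵀB - I‖²` (Frobenius norms).
The usual objective is the case `c = 1`. The penalty part of the gradient in `B` is
`2cβ(BBᵀB - B)` (see `gradB_eq` below), so that the case `c = 1/2` is the normalization in which
it is `βBBᵀB - βB`; likewise for `C`. -/
def J (A : Matrix (Fin M) (Fin N) ℝ) (c α β : ℝ) (B : Matrix (Fin M) (Fin P) ℝ)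
    (S : Matrix (Fin P) (Fin Q) ℝ) (C : Matrix (Fin Q) (Fin N) ℝ) : ℝ :=
  1 / 2 * frobSq (A - B * S * C) + c * α / 2 * frobSq (C * Cᵀ - 1) + c * β / 2 * frobSq (Bᵀ * B - 1)

/-- The matrix of partial derivatives of a function of a matrix variable. -/
def grad {m n : ℕ} (f : Matrix (Fin m) (Fin n) ℝ → ℝ) (X : Matrix (Fin m) (Fin n) ℝ) :
    Matrix (Fin m) (Fin n) ℝ :=
  Matrix.of fun i j => deriv (fun t : ℝ => f (X + t • Matrix.single i j (1 : ℝ))) 0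

/-- The partial gradient of `J` with respect to `B`. -/
def gradB (A : Matrix (Fin M) (Fin N) ℝ) (c α β : ℝ) (B : Matrix (Fin M) (Fin P) ℝ)
    (S : Matrix (Fin P) (Fin Q) ℝ) (C : Matrix (Fin Q) (Fin N) ℝ) : Matrix (Fin M) (Fin P) ℝ :=
  grad (fun X => J A c α β X S C) B

/-- The partial gradient of `J` with respect to `S`. -/
def gradS (A : Matrix (Fin M) (Fin N) ℝ) (c α β : ℝ) (B : Matrix (Fin M) (Fin P) ℝ)
    (S : Matrix (Fin P) (Fin Q) ℝ) (C : Matrix (Fin Q) (Fin N) ℝ) : Matrix (Fin P) (Fin Q) ℝ :=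
  grad (fun X => J A c α β B X C) S

/-- The partial gradient of `J` with respect to `C`. -/
def gradC (A : Matrix (Fin M) (Fin N) ℝ) (c α β : ℝ) (B : Matrix (Fin M) (Fin P) ℝ)
    (S : Matrix (Fin P) (Fin Q) ℝ) (C : Matrix (Fin Q) (Fin N) ℝ) : Matrix (Fin Q) (Fin N) ℝ :=
  grad (fun X => J A c α β B S X) C

/-- The Karush-Kuhn-Tucker conditions for minimizing `J` over entrywise nonnegative `B`, `S`, `C`:
feasibility, nonnegative multipliers (the partial gradients), complementary slackness. -/
structure IsKKT (A : Matrix (Fin M) (Fin N) ℝ) (c α β : ℝ) (B : Matrix (Fin M) (Fin P) ℝ)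
    (S : Matrix (Fin P) (Fin Q) ℝ) (C : Matrix (Fin Q) (Fin N) ℝ) : Prop where
  nonneg_B : Nonneg B
  nonneg_S : Nonneg S
  nonneg_C : Nonneg C
  grad_B : Nonneg (gradB A c α β B S C)
  grad_S : Nonneg (gradS A c α β B S C)
  grad_C : Nonneg (gradC A c α β B S C)
  slack_B : gradB A c α β B S C ⊙ B = 0
  slack_S : gradS A c α β B S C ⊙ S = 0
  slack_C : gradC A c α β B S C ⊙ C = 0

/-- The modified matrix `X̄`: an entry `x` is kept where the gradient entry is nonnegative and
replaced by `max x σ` otherwise. -/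
def bar {m n : ℕ} (σ : ℝ) (X G : Matrix (Fin m) (Fin n) ℝ) : Matrix (Fin m) (Fin n) ℝ :=
  Matrix.of fun i j => if 0 ≤ G i j then X i j else max (X i j) σ

/-- The additive update of `B`. -/
def updateB (A : Matrix (Fin M) (Fin N) ℝ) (c α β σ δ : ℝ) (B : Matrix (Fin M) (Fin P) ℝ)
    (S : Matrix (Fin P) (Fin Q) ℝ) (C : Matrix (Fin Q) (Fin N) ℝ) : Matrix (Fin M) (Fin P) ℝ :=
  let G := gradB A c α β B S C
  let B' := bar σ B G
  Matrix.of fun m p =>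
    B m p - B' m p * G m p / ((B' * S * C * Cᵀ * Sᵀ + β • (B' * B'ᵀ * B')) m p + δ)

/-- The additive update of `C`. -/
def updateC (A : Matrix (Fin M) (Fin N) ℝ) (c α β σ δ : ℝ) (B : Matrix (Fin M) (Fin P) ℝ)
    (S : Matrix (Fin P) (Fin Q) ℝ) (C : Matrix (Fin Q) (Fin N) ℝ) : Matrix (Fin Q) (Fin N) ℝ :=
  let G := gradC A c α β B S C
  let C' := bar σ C G
  Matrix.of fun q n =>
    C q n - C' q n * G q n / ((Sᵀ * Bᵀ * B * S * C' + α • (C' * C'ᵀ * C')) q n + δ)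

/-- The additive update of `S`. -/
def updateS (A : Matrix (Fin M) (Fin N) ℝ) (c α β σ δ : ℝ) (B : Matrix (Fin M) (Fin P) ℝ)
    (S : Matrix (Fin P) (Fin Q) ℝ) (C : Matrix (Fin Q) (Fin N) ℝ) : Matrix (Fin P) (Fin Q) ℝ :=
  let G := gradS A c α β B S C
  let S' := bar σ S G
  Matrix.of fun p q =>
    S p q - S' p q * G p q / ((Bᵀ * B * S' * C * Cᵀ) p q + δ)

/-- `(B k, S k, C k)` is the sequence generated by the additive-update algorithm with parameter
sequences `δB`, `δC`, `δS` from some nonnegative initial matrices: in each iteration `B`, then `C`,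
then `S` is updated, each time using the latest values of the other factors. -/
structure IsAURSequence (A : Matrix (Fin M) (Fin N) ℝ) (c α β σ : ℝ) (δB δC δS : ℕ → ℝ)
    (B : ℕ → Matrix (Fin M) (Fin P) ℝ) (S : ℕ → Matrix (Fin P) (Fin Q) ℝ)
    (C : ℕ → Matrix (Fin Q) (Fin N) ℝ) : Prop where
  init_B : Nonneg (B 0)
  init_S : Nonneg (S 0)
  init_C : Nonneg (C 0)
  step_B : ∀ k, B (k + 1) = updateB A c α β σ (δB k) (B k) (S k) (C k)
  step_C : ∀ k, C (k + 1) = updateC A c α β σ (δC k) (B (k + 1)) (S k) (C k)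
  step_S : ∀ k, S (k + 1) = updateS A c α β σ (δS k) (B (k + 1)) (S k) (C (k + 1))

end

/-! The closed forms of the partial gradients. -/

theorem frobSq_hasDerivAt {m n : ℕ} (X Y Z : Matrix (Fin m) (Fin n) ℝ) :
    HasDerivAt (fun t : ℝ => frobSq (X + t • Y + t ^ 2 • Z)) (2 * (Xᵀ * Y).trace) 0 := by
  have h : ∀ i j, HasDerivAt (fun t : ℝ => (X i j + t * Y i j + t ^ 2 * Z i j) ^ 2)
      (2 * (X i j * Y i j)) 0 := by
    intro i j
    have h1 : HasDerivAt (fun t : ℝ => X i j + t * Y i j + t ^ 2 * Z i j) (Y i j) 0 := by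
      have := (((hasDerivAt_id' (0 : ℝ)).mul_const (Y i j)).const_add (X i j)).fun_add
        (((hasDerivAt_id' (0 : ℝ)).fun_pow 2).mul_const (Z i j))
      exact this.congr_deriv (by simp)
    exact (h1.fun_pow 2).congr_deriv (by simp; ring)
  have h2 := HasDerivAt.fun_sum (u := Finset.univ) fun i _ =>
    HasDerivAt.fun_sum (u := Finset.univ) fun j _ => h i j
  refine h2.congr_deriv ?_
  rw [Finset.sum_comm]
  simp [Matrix.trace, Matrix.mul_apply, Finset.mul_sum]

theorem trace_mul_single' {m n : ℕ} (X : Matrix (Fin n) (Fin m) ℝ) (i : Fin m) (j : Fin n) :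
    (X * Matrix.single i j (1 : ℝ)).trace = X j i := by
  simp [Matrix.trace_mul_single]

theorem trace_symm {m n : ℕ} (K : Matrix (Fin n) (Fin n) ℝ) (hK : Kᵀ = K)
    (X E : Matrix (Fin m) (Fin n) ℝ) :
    (Kᵀ * (Eᵀ * X + Xᵀ * E)).trace = 2 * (K * Xᵀ * E).trace := by
  have : (K * (Eᵀ * X)).trace = (K * (Xᵀ * E)).trace := by
    rw [← Matrix.trace_transpose, Matrix.transpose_mul, hK, Matrix.trace_mul_comm]
    simp
  rw [hK, Matrix.mul_add, Matrix.trace_add, this, Matrix.mul_assoc]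
  ring

theorem gradB_hasDerivAt {M N P Q : ℕ} (A : Matrix (Fin M) (Fin N) ℝ) (c α β : ℝ)
    (B : Matrix (Fin M) (Fin P) ℝ) (S : Matrix (Fin P) (Fin Q) ℝ) (C : Matrix (Fin Q) (Fin N) ℝ)
    (m : Fin M) (p : Fin P) :
    HasDerivAt (fun t : ℝ => J A c α β (B + t • Matrix.single m p (1 : ℝ)) S C)
      ((B * S * C * Cᵀ * Sᵀ - A * Cᵀ * Sᵀ + (2 * c * β) • (B * Bᵀ * B) - (2 * c * β) • B) m p) 0 := by
  set E : Matrix (Fin M) (Fin P) ℝ := Matrix.single m p (1 : ℝ) with hE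
  have h1 := (frobSq_hasDerivAt (A - B * S * C) (-(E * S * C)) 0).const_mul (1 / 2 : ℝ)
  have h2 := (frobSq_hasDerivAt (Bᵀ * B - 1) (Eᵀ * B + Bᵀ * E) (Eᵀ * E)).const_mul (c * β / 2)
  have h := (h1.add_const (c * α / 2 * frobSq (C * Cᵀ - 1))).fun_add h2
  refine (h.congr_deriv ?_).congr_of_eventuallyEq (.of_forall fun t => ?_)
  rotate_left
  · have e1 : A - (B + t • E) * S * C = A - B * S * C + t • -(E * S * C) + t ^ 2 • 0 := by
      simp only [Matrix.add_mul, Matrix.smul_mul, smul_zero, add_zero, smul_neg]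
      abel
    have e2 : (B + t • E)ᵀ * (B + t • E) - 1 =
        Bᵀ * B - 1 + t • (Eᵀ * B + Bᵀ * E) + t ^ 2 • (Eᵀ * E) := by
      simp only [Matrix.transpose_add, Matrix.transpose_smul, Matrix.add_mul, Matrix.mul_add,
        Matrix.smul_mul, Matrix.mul_smul, smul_add, smul_smul, pow_two]
      abel
    simp only [J, e1, e2]
  · rw [trace_symm _ (by simp), Matrix.mul_neg, Matrix.trace_neg, Matrix.mul_assoc E,
      ← Matrix.mul_assoc _ E, Matrix.trace_mul_comm, ← Matrix.mul_assoc, hE, trace_mul_single',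
      trace_mul_single', ← Matrix.transpose_apply (_ * (_ - _)ᵀ), ← Matrix.transpose_apply (_ * Bᵀ)]
    simp only [Matrix.transpose_mul, Matrix.transpose_sub, Matrix.transpose_transpose,
      Matrix.transpose_one, Matrix.sub_mul, Matrix.mul_sub, Matrix.mul_one, Matrix.sub_apply,
      Matrix.add_apply, Matrix.smul_apply, smul_eq_mul, Matrix.mul_assoc]
    ring

theorem gradB_eq {M N P Q : ℕ} (A : Matrix (Fin M) (Fin N) ℝ) (c α β : ℝ)
    (B : Matrix (Fin M) (Fin P) ℝ) (S : Matrix (Fin P) (Fin Q) ℝ)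
    (C : Matrix (Fin Q) (Fin N) ℝ) :
    gradB A c α β B S C =
      B * S * C * Cᵀ * Sᵀ - A * Cᵀ * Sᵀ + (2 * c * β) • (B * Bᵀ * B) - (2 * c * β) • B := by
  ext m p
  exact (gradB_hasDerivAt A c α β B S C m p).deriv

theorem gradS_hasDerivAt {M N P Q : ℕ} (A : Matrix (Fin M) (Fin N) ℝ) (c α β : ℝ)
    (B : Matrix (Fin M) (Fin P) ℝ) (S : Matrix (Fin P) (Fin Q) ℝ) (C : Matrix (Fin Q) (Fin N) ℝ)
    (p : Fin P) (q : Fin Q) :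
    HasDerivAt (fun t : ℝ => J A c α β B (S + t • Matrix.single p q (1 : ℝ)) C)
      ((Bᵀ * B * S * C * Cᵀ - Bᵀ * A * Cᵀ) p q) 0 := by
  set E : Matrix (Fin P) (Fin Q) ℝ := Matrix.single p q (1 : ℝ) with hE
  have h1 := (frobSq_hasDerivAt (A - B * S * C) (-(B * E * C)) 0).const_mul (1 / 2 : ℝ)
  have h := (h1.add_const (c * α / 2 * frobSq (C * Cᵀ - 1))).add_const (c * β / 2 * frobSq (Bᵀ * B - 1))
  refine (h.congr_deriv ?_).congr_of_eventuallyEq (.of_forall fun t => ?_)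
  rotate_left
  · have e1 : A - B * (S + t • E) * C = A - B * S * C + t • -(B * E * C) + t ^ 2 • 0 := by
      simp only [Matrix.add_mul, Matrix.mul_add, Matrix.mul_smul, Matrix.smul_mul, smul_zero,
        add_zero, smul_neg]
      abel
    simp only [J, e1]
  · rw [Matrix.mul_neg, Matrix.trace_neg, ← Matrix.mul_assoc, Matrix.trace_mul_comm,
      ← Matrix.mul_assoc, ← Matrix.mul_assoc, hE, trace_mul_single',
      ← Matrix.transpose_apply (_ * _ * B)]
    simp only [Matrix.transpose_mul, Matrix.transpose_sub, Matrix.transpose_transpose,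
      Matrix.sub_mul, Matrix.mul_sub, Matrix.sub_apply, Matrix.mul_assoc]
    ring

theorem gradS_eq {M N P Q : ℕ} (A : Matrix (Fin M) (Fin N) ℝ) (c α β : ℝ)
    (B : Matrix (Fin M) (Fin P) ℝ) (S : Matrix (Fin P) (Fin Q) ℝ)
    (C : Matrix (Fin Q) (Fin N) ℝ) :
    gradS A c α β B S C = Bᵀ * B * S * C * Cᵀ - Bᵀ * A * Cᵀ := by
  ext p q
  exact (gradS_hasDerivAt A c α β B S C p q).deriv

theorem frobSq_transpose {m n : ℕ} (X : Matrix (Fin m) (Fin n) ℝ) : frobSq Xᵀ = frobSq X :=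
  Finset.sum_comm

theorem J_transpose {M N P Q : ℕ} (A : Matrix (Fin M) (Fin N) ℝ) (c α β : ℝ)
    (B : Matrix (Fin M) (Fin P) ℝ) (S : Matrix (Fin P) (Fin Q) ℝ)
    (C : Matrix (Fin Q) (Fin N) ℝ) : J Aᵀ c β α Cᵀ Sᵀ Bᵀ = J A c α β B S C := by
  unfold J
  rw [← frobSq_transpose (A - B * S * C)]
  simp only [Matrix.transpose_sub, Matrix.transpose_mul, Matrix.transpose_transpose,
    Matrix.mul_assoc]
  ring

theorem gradC_hasDerivAt {M N P Q : ℕ} (A : Matrix (Fin M) (Fin N) ℝ) (c α β : ℝ)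
    (B : Matrix (Fin M) (Fin P) ℝ) (S : Matrix (Fin P) (Fin Q) ℝ) (C : Matrix (Fin Q) (Fin N) ℝ)
    (q : Fin Q) (n : Fin N) :
    HasDerivAt (fun t : ℝ => J A c α β B S (C + t • Matrix.single q n (1 : ℝ)))
      ((Sᵀ * Bᵀ * B * S * C - Sᵀ * Bᵀ * A + (2 * c * α) • (C * Cᵀ * C) - (2 * c * α) • C) q n) 0 := by
  refine ((gradB_hasDerivAt Aᵀ c β α Cᵀ Sᵀ Bᵀ n q).congr_deriv ?_).congr_of_eventuallyEq
    (.of_forall fun t => ?_)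
  rotate_left
  · dsimp only
    rw [← J_transpose]
    simp
  · refine congrFun (congrFun (?_ : _ = (Sᵀ * Bᵀ * B * S * C - Sᵀ * Bᵀ * A +
      (2 * c * α) • (C * Cᵀ * C) - (2 * c * α) • C)ᵀ) n) q
    simp [Matrix.mul_assoc]

theorem gradC_eq {M N P Q : ℕ} (A : Matrix (Fin M) (Fin N) ℝ) (c α β : ℝ)
    (B : Matrix (Fin M) (Fin P) ℝ) (S : Matrix (Fin P) (Fin Q) ℝ)
    (C : Matrix (Fin Q) (Fin N) ℝ) :
    gradC A c α β B S C =
      Sᵀ * Bᵀ * B * S * C - Sᵀ * Bᵀ * A + (2 * c * α) • (C * Cᵀ * C) - (2 * c * α) • C := by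
  ext q n
  exact (gradC_hasDerivAt A c α β B S C q n).deriv

end BNMtF

namespace BNMtF

open scoped Matrix Topology
open Filter

/-! ### Frobenius norm and trace pairing -/

/-! Each update moves every entry against its partial derivative `g` by `b * g / d`, where `b` is
the barred entry and `d ≥ δ` the denominator. On a fixed box, `J` has in each factor a quadratic
upper bound with some constant `L` (`exists_J_le_B`, `exists_J_le_C`, `exists_J_le_S`). Large `δ`
therefore does two things: if it dominates the gradient entries, iterates stay nonnegative
(`step_nonneg`), and if it dominates `2 * L * ρ`, the first-order decrease beats the quadratic error
(`step_descent`). The update then lowers `J` by at least a fixed multiple of the energy `∑ b * g ^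
2`, the multiple being positive because the denominators are bounded above.

Since `J ≥ 0`, the decreases, hence the three energies, tend to zero. This has two consequences.
Consecutive iterates become close (`tendsto_step`), so the gradients of the later blocks, evaluated
at partly updated points, converge to the gradients at the limit point. And in the limit the
energies give complementary slackness, while the floor `σ` in `bar` excludes negative gradient
entries (`complementarity_of_tendsto`). -/

theorem frobSq_nonneg {m n : ℕ} (X : Matrix (Fin m) (Fin n) ℝ) : 0 ≤ frobSq X :=
  Finset.sum_nonneg fun _ _ => Finset.sum_nonneg fun _ _ => sq_nonneg _

theorem trace_transpose_mul_eq_sum {m n : ℕ} (X Y : Matrix (Fin m) (Fin n) ℝ) :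
    (Xᵀ * Y).trace = ∑ i, ∑ j, X i j * Y i j := by
  rw [Finset.sum_comm]
  simp [Matrix.trace, Matrix.mul_apply]

theorem frobSq_add {m n : ℕ} (X Y : Matrix (Fin m) (Fin n) ℝ) :
    frobSq (X + Y) = frobSq X + 2 * (Xᵀ * Y).trace + frobSq Y := by
  rw [trace_transpose_mul_eq_sum]
  simp only [frobSq, Finset.mul_sum, ← Finset.sum_add_distrib, Matrix.add_apply]
  exact Finset.sum_congr rfl fun i _ => Finset.sum_congr rfl fun j _ => by ring

theorem frobSq_neg {m n : ℕ} (X : Matrix (Fin m) (Fin n) ℝ) : frobSq (-X) = frobSq X := by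
  simp [frobSq]

theorem frobSq_add_le {m n : ℕ} (X Y : Matrix (Fin m) (Fin n) ℝ) :
    frobSq (X + Y) ≤ 2 * (frobSq X + frobSq Y) := by
  simp only [frobSq, Finset.mul_sum, ← Finset.sum_add_distrib, Matrix.add_apply]
  exact Finset.sum_le_sum fun i _ => Finset.sum_le_sum fun j _ => by
    nlinarith [sq_nonneg (X i j - Y i j)]

theorem frobSq_mul_le {l m n : ℕ} (X : Matrix (Fin l) (Fin m) ℝ) (Y : Matrix (Fin m) (Fin n) ℝ) :
    frobSq (X * Y) ≤ frobSq X * frobSq Y := by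
  rw [← frobSq_transpose Y]
  simp only [frobSq, Matrix.transpose_apply]
  rw [Finset.sum_mul_sum]
  exact Finset.sum_le_sum fun i _ => Finset.sum_le_sum fun j _ => by
    rw [Matrix.mul_apply]
    exact Finset.sum_mul_sq_le_sq_mul_sq _ _ _

theorem trace_transpose_mul_sq_le {m n : ℕ} (X Y : Matrix (Fin m) (Fin n) ℝ) :
    (Xᵀ * Y).trace ^ 2 ≤ frobSq X * frobSq Y := by
  rw [trace_transpose_mul_eq_sum]
  simp only [frobSq, ← Finset.sum_product']
  exact Finset.sum_mul_sq_le_sq_mul_sq _ _ _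

theorem J_nonneg {M N P Q : ℕ} (A : Matrix (Fin M) (Fin N) ℝ) {c α β : ℝ} (hc : 0 ≤ c)
    (hα : 0 ≤ α) (hβ : 0 ≤ β) (B : Matrix (Fin M) (Fin P) ℝ) (S : Matrix (Fin P) (Fin Q) ℝ)
    (C : Matrix (Fin Q) (Fin N) ℝ) : 0 ≤ J A c α β B S C := by
  have h1 := frobSq_nonneg (A - B * S * C)
  have h2 := frobSq_nonneg (C * Cᵀ - 1)
  have h3 := frobSq_nonneg (Bᵀ * B - 1)
  unfold J
  positivity

/-! ### Bounds on boxes -/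

/-- All entries of `X` are at most `ρ` in absolute value. -/
def InBox {m n : ℕ} (ρ : ℝ) (X : Matrix (Fin m) (Fin n) ℝ) : Prop := ∀ i j, |X i j| ≤ ρ

theorem isCompact_setOf_inBox (m n : ℕ) (ρ : ℝ) :
    IsCompact {X : Matrix (Fin m) (Fin n) ℝ | InBox ρ X} := by
  have h : IsCompact (Set.univ.pi fun _ : Fin m => Set.univ.pi fun _ : Fin n => Set.Icc (-ρ) ρ) :=
    isCompact_univ_pi fun _ => isCompact_univ_pi fun _ => isCompact_Icc
  refine (congrArg IsCompact (Set.ext fun X => ?_)).mp h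
  refine Set.mem_univ_pi.trans (forall_congr' fun i => Set.mem_univ_pi.trans
    (forall_congr' fun j => ?_))
  rw [Set.mem_Icc, abs_le]

theorem continuous_frobSq {m n : ℕ} :
    Continuous (frobSq : Matrix (Fin m) (Fin n) ℝ → ℝ) := by
  unfold frobSq
  fun_prop

/-- A continuous function is bounded on the compact product of three boxes. All constants of the
proof come from this, which makes them independent of the iterates. -/
theorem exists_frobSq_le_of_inBox {m n a b a' b' a'' b'' : ℕ} (ρ : ℝ)
    {F : Matrix (Fin a) (Fin b) ℝ × Matrix (Fin a') (Fin b') ℝ × Matrix (Fin a'') (Fin b'') ℝ →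
      Matrix (Fin m) (Fin n) ℝ} (hF : Continuous F) :
    ∃ K, 0 < K ∧ ∀ X Y Z, InBox ρ X → InBox ρ Y → InBox ρ Z → frobSq (F (X, Y, Z)) ≤ K := by
  obtain ⟨K, hK⟩ := ((isCompact_setOf_inBox a b ρ).prod
    ((isCompact_setOf_inBox a' b' ρ).prod (isCompact_setOf_inBox a'' b'' ρ))).exists_bound_of_continuousOn
      (continuous_frobSq.comp hF).continuousOn
  refine ⟨max K 1, by positivity, fun X Y Z hX hY hZ => ?_⟩
  exact (le_abs_self _).trans ((hK (X, Y, Z) ⟨hX, hY, hZ⟩).trans (le_max_left _ _))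

theorem abs_apply_le_of_frobSq_le {m n : ℕ} {X : Matrix (Fin m) (Fin n) ℝ} {K : ℝ}
    (h : frobSq X ≤ K) (i : Fin m) (j : Fin n) : |X i j| ≤ K + 1 := by
  have h1 : X i j ^ 2 ≤ frobSq X :=
    (Finset.single_le_sum (f := fun j => X i j ^ 2) (fun _ _ => sq_nonneg _)
      (Finset.mem_univ j)).trans
      (Finset.single_le_sum (f := fun i => ∑ j, X i j ^ 2)
        (fun _ _ => Finset.sum_nonneg fun _ _ => sq_nonneg _) (Finset.mem_univ i))
  rw [← sq_abs] at h1
  -- The crude bound `x ≤ x ^ 2 + 1` avoids a square root.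
  nlinarith [sq_nonneg (|X i j| - 1), abs_nonneg (X i j)]

theorem exists_inBox_of_inBox {m n a b a' b' a'' b'' : ℕ} (ρ : ℝ)
    {F : Matrix (Fin a) (Fin b) ℝ × Matrix (Fin a') (Fin b') ℝ × Matrix (Fin a'') (Fin b'') ℝ →
      Matrix (Fin m) (Fin n) ℝ} (hF : Continuous F) :
    ∃ K, 0 < K ∧ ∀ X Y Z, InBox ρ X → InBox ρ Y → InBox ρ Z → InBox K (F (X, Y, Z)) := by
  obtain ⟨K, hK, h⟩ := exists_frobSq_le_of_inBox ρ hF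
  exact ⟨K + 1, by positivity, fun X Y Z hX hY hZ =>
    abs_apply_le_of_frobSq_le (h X Y Z hX hY hZ)⟩

theorem InBox.transpose {m n : ℕ} {ρ : ℝ} {X : Matrix (Fin m) (Fin n) ℝ} (h : InBox ρ X) :
    InBox ρ Xᵀ := fun i j => h j i

/-! ### Quadratic upper bounds for the objective in each factor -/

section Descent

variable {M N P Q : ℕ} (A : Matrix (Fin M) (Fin N) ℝ) {c α β : ℝ}

/-- Exact expansion of a quartic: everything beyond first order in `E` is in the last bracket.
Leaving `B + E` unexpanded there hides the cubic and quartic terms in a factor that is bounded as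
soon as the endpoint lies in the box. -/
theorem J_add_B (B E : Matrix (Fin M) (Fin P) ℝ) (S : Matrix (Fin P) (Fin Q) ℝ)
    (C : Matrix (Fin Q) (Fin N) ℝ) :
    J A c α β (B + E) S C = J A c α β B S C + ((gradB A c α β B S C)ᵀ * E).trace +
      (1 / 2 * frobSq (E * (S * C)) + c * β / 2 * (2 * ((Bᵀ * B - 1)ᵀ * (Eᵀ * E)).trace +
        frobSq (Eᵀ * (B + E) + Bᵀ * E))) := by
  have e1 : A - (B + E) * S * C = (A - B * S * C) + -(E * (S * C)) := by
    simp only [Matrix.add_mul, Matrix.mul_assoc]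
    abel
  have e2 : (B + E)ᵀ * (B + E) - 1 = (Bᵀ * B - 1) + (Eᵀ * (B + E) + Bᵀ * E) := by
    simp only [Matrix.transpose_add, Matrix.add_mul, Matrix.mul_add]
    abel
  have e3 : Eᵀ * (B + E) + Bᵀ * E = (Eᵀ * B + Bᵀ * E) + Eᵀ * E := by
    simp only [Matrix.mul_add]
    abel
  have e4 : ((A - B * S * C)ᵀ * (E * (S * C))).trace = ((S * C) * (A - B * S * C)ᵀ * E).trace := by
    rw [← Matrix.mul_assoc, Matrix.trace_mul_comm]
    simp only [Matrix.mul_assoc]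
  have e5 := trace_symm (Bᵀ * B - 1) (by simp) B E
  have e6 : ((gradB A c α β B S C)ᵀ * E).trace = -((S * C) * (A - B * S * C)ᵀ * E).trace +
      2 * c * β * ((Bᵀ * B - 1) * Bᵀ * E).trace := by
    rw [gradB_eq, ← Matrix.trace_neg, ← smul_eq_mul (a := 2 * c * β), ← Matrix.trace_smul,
      ← Matrix.trace_add]
    congr 1
    simp only [Matrix.transpose_sub, Matrix.transpose_add, Matrix.transpose_mul,
      Matrix.transpose_smul, Matrix.transpose_transpose, Matrix.sub_mul, Matrix.add_mul,
      Matrix.mul_sub, Matrix.smul_mul, Matrix.one_mul, Matrix.mul_assoc, smul_sub]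
    abel
  simp only [J]
  rw [e1, e2, frobSq_add, frobSq_add (Bᵀ * B - 1), frobSq_neg, e6, e3,
    Matrix.mul_add (Bᵀ * B - 1)ᵀ, Matrix.trace_add, e5, Matrix.mul_neg, Matrix.trace_neg, e4]
  ring

theorem exists_J_le_B (hc : 0 ≤ c) (hβ : 0 ≤ β) (ρ : ℝ) :
    ∃ L : ℝ, 0 ≤ L ∧ ∀ (B B' : Matrix (Fin M) (Fin P) ℝ) (S : Matrix (Fin P) (Fin Q) ℝ)
      (C : Matrix (Fin Q) (Fin N) ℝ), InBox ρ B → InBox ρ B' → InBox ρ S → InBox ρ C →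
      J A c α β B' S C ≤ J A c α β B S C + ((gradB A c α β B S C)ᵀ * (B' - B)).trace +
        L * frobSq (B' - B) := by
  obtain ⟨K₁, hK₁, h₁⟩ := exists_frobSq_le_of_inBox (a := M) (b := P) (a' := P) (b' := Q)
    (a'' := Q) (b'' := N) ρ (F := fun x => x.2.1 * x.2.2) (by fun_prop)
  obtain ⟨K₂, hK₂, h₂⟩ := exists_frobSq_le_of_inBox (a := M) (b := P) (a' := P) (b' := Q)
    (a'' := Q) (b'' := N) ρ (F := fun x => x.1ᵀ * x.1 - 1) (by fun_prop)
  obtain ⟨K₃, hK₃, h₃⟩ := exists_frobSq_le_of_inBox (a := M) (b := P) (a' := P) (b' := Q)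
    (a'' := Q) (b'' := N) ρ (F := fun x => x.1) (by fun_prop)
  refine ⟨1 / 2 * K₁ + c * β / 2 * (K₂ + 1 + 4 * K₃), by positivity,
    fun B B' S C hB hB' hS hC => ?_⟩
  obtain ⟨E, rfl⟩ : ∃ E, B' = B + E := ⟨B' - B, by abel⟩
  rw [J_add_B, add_sub_cancel_left, add_assoc, add_assoc]
  gcongr
  have hE := frobSq_nonneg E
  have b1 : frobSq (E * (S * C)) ≤ K₁ * frobSq E := by
    nlinarith [frobSq_mul_le E (S * C), mul_le_mul_of_nonneg_left (h₁ B S C hB hS hC) hE]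
  have b2 : 2 * ((Bᵀ * B - 1)ᵀ * (Eᵀ * E)).trace ≤ (K₂ + 1) * frobSq E := by
    have t1 := trace_transpose_mul_sq_le (Bᵀ * B - 1) (Eᵀ * E)
    have t2 := frobSq_mul_le Eᵀ E
    rw [frobSq_transpose] at t2
    have t3 : frobSq (Bᵀ * B - 1) ≤ K₂ := h₂ B S C hB hS hC
    have t4 := frobSq_nonneg (Eᵀ * E)
    refine (abs_le_of_sq_le_sq' ?_ (by positivity)).2
    calc (2 * ((Bᵀ * B - 1)ᵀ * (Eᵀ * E)).trace) ^ 2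
        ≤ 4 * (frobSq (Bᵀ * B - 1) * frobSq (Eᵀ * E)) := by rw [mul_pow]; linarith
      _ ≤ 4 * (K₂ * (frobSq E * frobSq E)) := by gcongr
      -- This is `4 * K₂ ≤ (K₂ + 1) ^ 2`, again in place of a square root.
      _ ≤ ((K₂ + 1) * frobSq E) ^ 2 := by
        nlinarith [mul_nonneg (sq_nonneg (K₂ - 1)) (sq_nonneg (frobSq E))]
  have b3 : frobSq (Eᵀ * (B + E) + Bᵀ * E) ≤ 4 * K₃ * frobSq E := by
    have t1 := frobSq_mul_le Eᵀ (B + E)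
    have t2 := frobSq_mul_le Bᵀ E
    rw [frobSq_transpose] at t1 t2
    have t3 : frobSq (B + E) ≤ K₃ := h₃ (B + E) S C hB' hS hC
    have t4 : frobSq B ≤ K₃ := h₃ B S C hB hS hC
    nlinarith [frobSq_add_le (Eᵀ * (B + E)) (Bᵀ * E), mul_le_mul_of_nonneg_left t3 hE,
      mul_le_mul_of_nonneg_right t4 hE]
  calc _ ≤ 1 / 2 * (K₁ * frobSq E) + c * β / 2 * ((K₂ + 1) * frobSq E + 4 * K₃ * frobSq E) := by
        gcongr
    _ = _ := by ring

theorem gradC_eq_transpose (B : Matrix (Fin M) (Fin P) ℝ) (S : Matrix (Fin P) (Fin Q) ℝ)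
    (C : Matrix (Fin Q) (Fin N) ℝ) :
    gradC A c α β B S C = (gradB Aᵀ c β α Cᵀ Sᵀ Bᵀ)ᵀ := by
  rw [gradC_eq, gradB_eq]
  simp [Matrix.mul_assoc]

/-- Transposing the factorization exchanges `B` with `C` and `α` with `β`, so the bound for `B`
applies. -/
theorem exists_J_le_C (hc : 0 ≤ c) (hα : 0 ≤ α) (ρ : ℝ) :
    ∃ L : ℝ, 0 ≤ L ∧ ∀ (B : Matrix (Fin M) (Fin P) ℝ) (S : Matrix (Fin P) (Fin Q) ℝ)
      (C C' : Matrix (Fin Q) (Fin N) ℝ), InBox ρ B → InBox ρ S → InBox ρ C → InBox ρ C' →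
      J A c α β B S C' ≤ J A c α β B S C + ((gradC A c α β B S C)ᵀ * (C' - C)).trace +
        L * frobSq (C' - C) := by
  obtain ⟨L, hL, h⟩ := exists_J_le_B (P := Q) (Q := P) (α := β) Aᵀ hc hα ρ
  refine ⟨L, hL, fun B S C C' hB hS hC hC' => ?_⟩
  have := h Cᵀ C'ᵀ Sᵀ Bᵀ hC.transpose hC'.transpose hS.transpose hB.transpose
  rw [J_transpose, J_transpose, ← Matrix.transpose_sub, frobSq_transpose,
    ← Matrix.trace_transpose, Matrix.transpose_mul, Matrix.trace_mul_comm] at this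
  rw [gradC_eq_transpose]
  simpa using this

/-- The penalties do not involve `S`, so `J` is exactly quadratic in it. -/
theorem J_add_S (B : Matrix (Fin M) (Fin P) ℝ) (S E : Matrix (Fin P) (Fin Q) ℝ)
    (C : Matrix (Fin Q) (Fin N) ℝ) :
    J A c α β B (S + E) C = J A c α β B S C + ((gradS A c α β B S C)ᵀ * E).trace +
      1 / 2 * frobSq (B * E * C) := by
  have e1 : A - B * (S + E) * C = (A - B * S * C) + -(B * E * C) := by
    simp only [Matrix.add_mul, Matrix.mul_add]
    abel
  have e2 : ((A - B * S * C)ᵀ * (B * E * C)).trace = (C * (A - B * S * C)ᵀ * B * E).trace := by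
    rw [← Matrix.mul_assoc, Matrix.trace_mul_comm]
    simp only [Matrix.mul_assoc]
  have e3 : ((gradS A c α β B S C)ᵀ * E).trace = -(C * (A - B * S * C)ᵀ * B * E).trace := by
    rw [gradS_eq, ← Matrix.trace_neg]
    congr 1
    simp only [Matrix.transpose_sub, Matrix.transpose_mul, Matrix.transpose_transpose,
      Matrix.sub_mul, Matrix.mul_sub, Matrix.mul_assoc, neg_sub]
  simp only [J]
  rw [e1, frobSq_add, frobSq_neg, Matrix.mul_neg, Matrix.trace_neg, e2, e3]
  ring

theorem exists_J_le_S (ρ : ℝ) :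
    ∃ L : ℝ, 0 ≤ L ∧ ∀ (B : Matrix (Fin M) (Fin P) ℝ) (S S' : Matrix (Fin P) (Fin Q) ℝ)
      (C : Matrix (Fin Q) (Fin N) ℝ), InBox ρ B → InBox ρ S → InBox ρ S' → InBox ρ C →
      J A c α β B S' C ≤ J A c α β B S C + ((gradS A c α β B S C)ᵀ * (S' - S)).trace +
        L * frobSq (S' - S) := by
  obtain ⟨K₁, hK₁, h₁⟩ := exists_frobSq_le_of_inBox (a := M) (b := P) (a' := P) (b' := Q)
    (a'' := Q) (b'' := N) ρ (F := fun x => x.1) (by fun_prop)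
  obtain ⟨K₂, hK₂, h₂⟩ := exists_frobSq_le_of_inBox (a := M) (b := P) (a' := P) (b' := Q)
    (a'' := Q) (b'' := N) ρ (F := fun x => x.2.2) (by fun_prop)
  refine ⟨1 / 2 * (K₁ * K₂), by positivity, fun B S S' C hB hS hS' hC => ?_⟩
  obtain ⟨E, rfl⟩ : ∃ E, S' = S + E := ⟨S' - S, by abel⟩
  rw [J_add_S, add_sub_cancel_left]
  refine add_le_add_right ?_ _
  have hE := frobSq_nonneg E
  have t1 : frobSq B ≤ K₁ := h₁ B S C hB hS hC
  have t2 : frobSq C ≤ K₂ := h₂ B S C hB hS hC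
  calc 1 / 2 * frobSq (B * E * C) ≤ 1 / 2 * (frobSq B * frobSq E * frobSq C) := by
        have := frobSq_nonneg C
        gcongr
        exact (frobSq_mul_le _ _).trans (by gcongr; exact frobSq_mul_le _ _)
    _ ≤ 1 / 2 * (K₁ * frobSq E * K₂) := by
        have := frobSq_nonneg C
        gcongr
    _ = _ := by ring

end Descent

/-! ### The additive step on a single factor -/

section Step

variable {m n : ℕ}

/-- The additive step from `X` along the gradient `G` with denominators `D + δ`. -/
noncomputable def step (σ δ : ℝ) (X G D : Matrix (Fin m) (Fin n) ℝ) : Matrix (Fin m) (Fin n) ℝ :=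
  Matrix.of fun i j => X i j - bar σ X G i j * G i j / (D i j + δ)

/-- The weighted squared size of the gradient that controls the decrease of the objective. -/
noncomputable def energy (σ : ℝ) (X G : Matrix (Fin m) (Fin n) ℝ) : ℝ :=
  ∑ i, ∑ j, bar σ X G i j * G i j ^ 2

variable {σ δ ρ L T : ℝ} {X G D : Matrix (Fin m) (Fin n) ℝ}

theorem bar_nonneg (hX : Nonneg X) : Nonneg (bar σ X G) := fun i j => by
  simp only [bar, Matrix.of_apply]
  split_ifs
  exacts [hX i j, (hX i j).trans (le_max_left _ _)]

theorem bar_inBox (hσ : 0 < σ) (hσρ : σ ≤ ρ) (hX : InBox ρ X) : InBox ρ (bar σ X G) := fun i j => by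
  simp only [bar, Matrix.of_apply]
  split_ifs
  · exact hX i j
  · rw [abs_of_nonneg (hσ.le.trans (le_max_right _ _))]
    exact max_le ((le_abs_self _).trans (hX i j)) hσρ

theorem energy_nonneg (hX : Nonneg X) : 0 ≤ energy σ X G :=
  Finset.sum_nonneg fun i _ => Finset.sum_nonneg fun j _ =>
    mul_nonneg (bar_nonneg hX i j) (sq_nonneg _)

theorem bar_mul_sq_le_energy (hX : Nonneg X) (i : Fin m) (j : Fin n) :
    bar σ X G i j * G i j ^ 2 ≤ energy σ X G := by
  have h : ∀ i j, 0 ≤ bar σ X G i j * G i j ^ 2 := fun i j =>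
    mul_nonneg (bar_nonneg hX i j) (sq_nonneg _)
  exact (Finset.single_le_sum (f := fun j => bar σ X G i j * G i j ^ 2) (fun j _ => h i j)
    (Finset.mem_univ j)).trans (Finset.single_le_sum (f := fun i => ∑ j, bar σ X G i j * G i j ^ 2)
      (fun i _ => Finset.sum_nonneg fun j _ => h i j) (Finset.mem_univ i))

/-- Where `g ≥ 0` the entry is multiplied by `1 - g / (D + δ)`, which is nonnegative since `g ≤ δ`;
where `g < 0` it does not decrease. -/
theorem step_nonneg (hX : Nonneg X) (hD : Nonneg D) (hδ : 0 < δ) (hG : InBox δ G) :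
    Nonneg (step σ δ X G D) := fun i j => by
  have hd : 0 < D i j + δ := by linarith [hD i j]
  have hx := hX i j
  simp only [step, Matrix.of_apply, sub_nonneg]
  rw [div_le_iff₀ hd]
  by_cases hg : 0 ≤ G i j
  · simp only [bar, Matrix.of_apply, if_pos hg]
    have := (le_abs_self _).trans (hG i j)
    gcongr
    linarith [hD i j]
  · nlinarith [bar_nonneg (σ := σ) (G := G) hX i j, mul_nonneg hx hd.le]

/-- Both the linear and the quadratic term split into entries, each contributing `-(b * g ^ 2 / d) *
(1 - L * b / d)`. The condition on `δ` makes the last factor at least `1 / 2`, and `d ≤ T` gives a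
uniform rate. -/
theorem step_descent (hX : Nonneg X) (hD : Nonneg D) (hδ : 0 < δ) (hL : 0 ≤ L)
    (hbar : InBox ρ (bar σ X G)) (hLδ : 2 * L * ρ ≤ δ) (hT : ∀ i j, D i j + δ ≤ T)
    {a b : ℝ} (hab : b ≤ a + (Gᵀ * (step σ δ X G D - X)).trace + L * frobSq (step σ δ X G D - X)) :
    b ≤ a - energy σ X G / (2 * T) := by
  suffices h : (Gᵀ * (step σ δ X G D - X)).trace + L * frobSq (step σ δ X G D - X) ≤
      -(energy σ X G / (2 * T)) by linarith
  rw [trace_transpose_mul_eq_sum, energy, Finset.sum_div, frobSq, Finset.mul_sum,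
    ← Finset.sum_add_distrib, ← Finset.sum_neg_distrib]
  refine Finset.sum_le_sum fun i _ => ?_
  rw [Finset.sum_div, Finset.mul_sum, ← Finset.sum_add_distrib, ← Finset.sum_neg_distrib]
  refine Finset.sum_le_sum fun j _ => ?_
  have hd : 0 < D i j + δ := by linarith [hD i j]
  have hb := bar_nonneg (σ := σ) (G := G) hX i j
  have hbρ := (le_abs_self _).trans (hbar i j)
  have hT' := hT i j
  have hD' := hD i j
  simp only [step, Matrix.sub_apply, Matrix.of_apply, sub_sub_cancel_left]
  set b := bar σ X G i j
  set g := G i j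
  set d := D i j + δ
  have h1 : L * b / d ≤ 1 / 2 := by
    rw [div_le_iff₀ hd]
    nlinarith [mul_le_mul_of_nonneg_left hbρ hL]
  have h2 : b * g ^ 2 / (2 * T) ≤ b * g ^ 2 / (2 * d) := by gcongr
  have h3 : 0 ≤ b * g ^ 2 / d := by positivity
  have h4 : g * -(b * g / d) + L * (-(b * g / d)) ^ 2 = -(b * g ^ 2 / d) * (1 - L * b / d) := by
    field_simp
    ring
  have h5 : b * g ^ 2 / (2 * d) = b * g ^ 2 / d * (1 / 2) := by
    field_simp
  rw [h4]
  nlinarith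

/-- The squared displacement is `b * (b * g ^ 2) / d ^ 2`: one factor `b` is bounded by `ρ`, the
rest by the energy. -/
theorem step_sub_sq_le {δ₀ : ℝ} (hX : Nonneg X) (hD : Nonneg D) (hδ₀ : 0 < δ₀) (hδ : δ₀ ≤ δ)
    (hbar : InBox ρ (bar σ X G)) (i : Fin m) (j : Fin n) :
    (step σ δ X G D i j - X i j) ^ 2 ≤ ρ / δ₀ ^ 2 * energy σ X G := by
  have hd : δ₀ ≤ D i j + δ := by linarith [hD i j]
  have hb := bar_nonneg (σ := σ) (G := G) hX i j
  have hbρ := (le_abs_self _).trans (hbar i j)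
  have he := bar_mul_sq_le_energy (σ := σ) (G := G) hX i j
  simp only [step, Matrix.of_apply, sub_sub_cancel_left]
  calc (-(bar σ X G i j * G i j / (D i j + δ))) ^ 2
      = bar σ X G i j * (bar σ X G i j * G i j ^ 2) / (D i j + δ) ^ 2 := by
        rw [neg_sq, div_pow]; ring
    _ ≤ ρ * energy σ X G / δ₀ ^ 2 := by
        have := hb.trans hbρ
        have := energy_nonneg (σ := σ) (G := G) hX
        gcongr
    _ = _ := by ring

theorem tendsto_step {ι : Type*} {l : Filter ι} {X G D : ι → Matrix (Fin m) (Fin n) ℝ}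
    {δ : ι → ℝ} {δ₀ : ℝ} {X' : Matrix (Fin m) (Fin n) ℝ} (hX : ∀ k, Nonneg (X k))
    (hD : ∀ k, Nonneg (D k)) (hδ₀ : 0 < δ₀) (hδ : ∀ k, δ₀ ≤ δ k)
    (hbar : ∀ k, InBox ρ (bar σ (X k) (G k)))
    (he : Tendsto (fun k => energy σ (X k) (G k)) l (𝓝 0)) (hlim : Tendsto X l (𝓝 X')) :
    Tendsto (fun k => step σ (δ k) (X k) (G k) (D k)) l (𝓝 X') := by
  refine tendsto_pi_nhds.2 fun i => tendsto_pi_nhds.2 fun j => ?_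
  have h1 : Tendsto (fun k => X k i j) l (𝓝 (X' i j)) :=
    tendsto_pi_nhds.1 (tendsto_pi_nhds.1 hlim i) j
  have h2 : Tendsto (fun k => (step σ (δ k) (X k) (G k) (D k) i j - X k i j) ^ 2) l (𝓝 0) :=
    squeeze_zero (fun _ => sq_nonneg _)
      (fun k => step_sub_sq_le (hX k) (hD k) hδ₀ (hδ k) (hbar k) i j)
      (by simpa using he.const_mul (ρ / δ₀ ^ 2))
  have h3 : Tendsto (fun k => step σ (δ k) (X k) (G k) (D k) i j - X k i j) l (𝓝 0) := by
    have := h2.sqrt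
    simp only [Real.sqrt_sq_eq_abs, Real.sqrt_zero] at this
    exact (tendsto_zero_iff_abs_tendsto_zero _).2 this
  simpa using h3.add h1

theorem complementarity_of_tendsto {ι : Type*} {l : Filter ι} [l.NeBot]
    {X G : ι → Matrix (Fin m) (Fin n) ℝ} {X' G' : Matrix (Fin m) (Fin n) ℝ} (hσ : 0 < σ)
    (hX : ∀ k, Nonneg (X k)) (he : Tendsto (fun k => energy σ (X k) (G k)) l (𝓝 0))
    (hlim : Tendsto X l (𝓝 X')) (hG : Tendsto G l (𝓝 G')) :
    Nonneg X' ∧ Nonneg G' ∧ G' ⊙ X' = 0 := by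
  have hXij : ∀ i j, Tendsto (fun k => X k i j) l (𝓝 (X' i j)) := fun i j =>
    tendsto_pi_nhds.1 (tendsto_pi_nhds.1 hlim i) j
  have hGij : ∀ i j, Tendsto (fun k => G k i j) l (𝓝 (G' i j)) := fun i j =>
    tendsto_pi_nhds.1 (tendsto_pi_nhds.1 hG i) j
  have hX' : Nonneg X' := fun i j => ge_of_tendsto' (hXij i j) fun k => hX k i j
  have hG' : Nonneg G' := fun i j => by
    by_contra! hneg
    -- A negative limit makes the gradient entry eventually negative, so the barred entry is at
    -- least `σ` even if the iterate's entry is zero.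
    have h1 : σ * G' i j ^ 2 ≤ 0 := by
      refine le_of_tendsto_of_tendsto (((hGij i j).pow 2).const_mul σ) he ?_
      filter_upwards [(hGij i j).eventually_lt_const hneg] with k hk
      refine le_trans ?_ (bar_mul_sq_le_energy (hX k) i j)
      simp only [bar, Matrix.of_apply, if_neg (not_le.2 hk)]
      gcongr
      exact le_max_right _ _
    nlinarith [mul_pos hσ (pow_pos (neg_pos.2 hneg) 2)]
  refine ⟨hX', hG', ?_⟩
  ext i j
  -- The barred entry is never below the original one, so the energy controls this product too.
  have h1 : X' i j * G' i j ^ 2 ≤ 0 := by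
    refine le_of_tendsto_of_tendsto' ((hXij i j).mul ((hGij i j).pow 2)) he fun k => ?_
    refine le_trans ?_ (bar_mul_sq_le_energy (hX k) i j)
    gcongr
    simp only [bar, Matrix.of_apply]
    split_ifs
    exacts [le_rfl, le_max_left _ _]
  have h2 : X' i j * G' i j ^ 2 = 0 := le_antisymm h1 (mul_nonneg (hX' i j) (sq_nonneg _))
  simpa [or_comm] using h2

end Step

/-- The sequence `a` decreases and is bounded below, so its increments, which dominate `d`, vanish
in the limit. -/
theorem tendsto_zero_of_le_sub {a d : ℕ → ℝ} (ha : ∀ k, 0 ≤ a k) (hd : ∀ k, 0 ≤ d k)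
    (h : ∀ k, a (k + 1) ≤ a k - d k) : Tendsto d atTop (𝓝 0) := by
  have hanti : Antitone a := antitone_nat_of_succ_le fun k => by linarith [h k, hd k]
  have hlim := tendsto_atTop_ciInf hanti ⟨0, by rintro _ ⟨k, rfl⟩; exact ha k⟩
  refine squeeze_zero hd (fun k => (le_sub_comm.1 (h k) : d k ≤ a k - a (k + 1))) ?_
  simpa using hlim.sub (hlim.comp (tendsto_add_atTop_nat 1))

/-! ### Nonnegativity of the denominators -/

section Nonneg

variable {l m n : ℕ}

theorem Nonneg.mul {X : Matrix (Fin l) (Fin m) ℝ} {Y : Matrix (Fin m) (Fin n) ℝ} (hX : Nonneg X)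
    (hY : Nonneg Y) : Nonneg (X * Y) := fun i j => by
  rw [Matrix.mul_apply]
  exact Finset.sum_nonneg fun k _ => mul_nonneg (hX i k) (hY k j)

theorem Nonneg.add {X Y : Matrix (Fin m) (Fin n) ℝ} (hX : Nonneg X) (hY : Nonneg Y) :
    Nonneg (X + Y) := fun i j => add_nonneg (hX i j) (hY i j)

theorem Nonneg.smul {X : Matrix (Fin m) (Fin n) ℝ} {r : ℝ} (hr : 0 ≤ r) (hX : Nonneg X) :
    Nonneg (r • X) := fun i j => mul_nonneg hr (hX i j)

theorem Nonneg.transpose {X : Matrix (Fin m) (Fin n) ℝ} (hX : Nonneg X) : Nonneg Xᵀ :=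
  fun i j => hX j i

end Nonneg

section Blocks

variable {M N P Q : ℕ} (A : Matrix (Fin M) (Fin N) ℝ) (c α β : ℝ)

/-- The denominator matrix (without `δ`) of the update of `B`. -/
def denomB (β : ℝ) (B : Matrix (Fin M) (Fin P) ℝ) (S : Matrix (Fin P) (Fin Q) ℝ)
    (C : Matrix (Fin Q) (Fin N) ℝ) : Matrix (Fin M) (Fin P) ℝ :=
  B * S * C * Cᵀ * Sᵀ + β • (B * Bᵀ * B)

/-- The denominator matrix (without `δ`) of the update of `C`. -/
def denomC (α : ℝ) (B : Matrix (Fin M) (Fin P) ℝ) (S : Matrix (Fin P) (Fin Q) ℝ)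
    (C : Matrix (Fin Q) (Fin N) ℝ) : Matrix (Fin Q) (Fin N) ℝ :=
  Sᵀ * Bᵀ * B * S * C + α • (C * Cᵀ * C)

/-- The denominator matrix (without `δ`) of the update of `S`. -/
def denomS (B : Matrix (Fin M) (Fin P) ℝ) (S : Matrix (Fin P) (Fin Q) ℝ)
    (C : Matrix (Fin Q) (Fin N) ℝ) : Matrix (Fin P) (Fin Q) ℝ :=
  Bᵀ * B * S * C * Cᵀ

variable {β} in
theorem Nonneg.denomB {B : Matrix (Fin M) (Fin P) ℝ} {S : Matrix (Fin P) (Fin Q) ℝ}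
    {C : Matrix (Fin Q) (Fin N) ℝ} (hβ : 0 ≤ β) (hB : Nonneg B) (hS : Nonneg S) (hC : Nonneg C) :
    Nonneg (denomB β B S C) :=
  ((((hB.mul hS).mul hC).mul hC.transpose).mul hS.transpose).add
    (((hB.mul hB.transpose).mul hB).smul hβ)

variable {α} in
theorem Nonneg.denomC {B : Matrix (Fin M) (Fin P) ℝ} {S : Matrix (Fin P) (Fin Q) ℝ}
    {C : Matrix (Fin Q) (Fin N) ℝ} (hα : 0 ≤ α) (hB : Nonneg B) (hS : Nonneg S) (hC : Nonneg C) :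
    Nonneg (denomC α B S C) :=
  ((((hS.transpose.mul hB.transpose).mul hB).mul hS).mul hC).add
    (((hC.mul hC.transpose).mul hC).smul hα)

theorem Nonneg.denomS {B : Matrix (Fin M) (Fin P) ℝ} {S : Matrix (Fin P) (Fin Q) ℝ}
    {C : Matrix (Fin Q) (Fin N) ℝ} (hB : Nonneg B) (hS : Nonneg S) (hC : Nonneg C) :
    Nonneg (denomS B S C) :=
  (((hB.transpose.mul hB).mul hS).mul hC).mul hC.transpose

/-! ### Continuity of the partial gradients -/

theorem continuous_gradB : Continuous fun x : Matrix (Fin M) (Fin P) ℝ × Matrix (Fin P) (Fin Q) ℝ ×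
    Matrix (Fin Q) (Fin N) ℝ => gradB A c α β x.1 x.2.1 x.2.2 := by
  simp only [gradB_eq]
  fun_prop

theorem continuous_gradC : Continuous fun x : Matrix (Fin M) (Fin P) ℝ × Matrix (Fin P) (Fin Q) ℝ ×
    Matrix (Fin Q) (Fin N) ℝ => gradC A c α β x.1 x.2.1 x.2.2 := by
  simp only [gradC_eq]
  fun_prop

theorem continuous_gradS : Continuous fun x : Matrix (Fin M) (Fin P) ℝ × Matrix (Fin P) (Fin Q) ℝ ×
    Matrix (Fin Q) (Fin N) ℝ => gradS A c α β x.1 x.2.1 x.2.2 := by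
  simp only [gradS_eq]
  fun_prop

theorem tendsto_of_continuous_triple {ι X Y Z W : Type*} [TopologicalSpace X] [TopologicalSpace Y]
    [TopologicalSpace Z] [TopologicalSpace W] {l : Filter ι} {f : X → Y → Z → W}
    (hf : Continuous fun x : X × Y × Z => f x.1 x.2.1 x.2.2) {x : ι → X} {y : ι → Y} {z : ι → Z}
    {x' : X} {y' : Y} {z' : Z} (hx : Tendsto x l (𝓝 x')) (hy : Tendsto y l (𝓝 y'))
    (hz : Tendsto z l (𝓝 z')) : Tendsto (fun k => f (x k) (y k) (z k)) l (𝓝 (f x' y' z')) :=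
  (hf.tendsto (x', y', z')).comp (hx.prodMk_nhds (hy.prodMk_nhds hz))

end Blocks

end BNMtF

/-! ### Convergence of the algorithm -/

open Filter Topology BNMtF in
theorem theorem9 {M N P Q : ℕ} (A : Matrix (Fin M) (Fin N) ℝ) (hA : BNMtF.Nonneg A)
    (c α β σ : ℝ) (hc : 0 ≤ c) (hα : 0 ≤ α) (hβ : 0 ≤ β) (hσ : 0 < σ) (R : ℝ) :
    ∃ δ₀ : ℝ, 0 < δ₀ ∧ ∀ δB δC δS : ℕ → ℝ,
      (∀ k, δ₀ ≤ δB k) → (∀ k, δ₀ ≤ δC k) → (∀ k, δ₀ ≤ δS k) →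
      BddAbove (Set.range δB) → BddAbove (Set.range δC) → BddAbove (Set.range δS) →
      ∀ (B : ℕ → Matrix (Fin M) (Fin P) ℝ) (S : ℕ → Matrix (Fin P) (Fin Q) ℝ)
        (C : ℕ → Matrix (Fin Q) (Fin N) ℝ),
        BNMtF.IsAURSequence A c α β σ δB δC δS B S C →
        (∀ k m p, |B k m p| ≤ R) → (∀ k p q, |S k p q| ≤ R) → (∀ k q n, |C k q n| ≤ R) →
        ∀ (B' : Matrix (Fin M) (Fin P) ℝ) (S' : Matrix (Fin P) (Fin Q) ℝ)
          (C' : Matrix (Fin Q) (Fin N) ℝ),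
          MapClusterPt (B', S', C') Filter.atTop (fun k => (B k, S k, C k)) →
          BNMtF.IsKKT A c α β B' S' C' := by
  -- The box must also contain the barred matrices, whose entries may be raised to `σ`.
  set ρ := max R σ with hρ
  have hσρ : σ ≤ ρ := le_max_right _ _
  have hρ0 : 0 < ρ := hσ.trans_le hσρ
  obtain ⟨KB, hKB, hGB⟩ := exists_inBox_of_inBox ρ (continuous_gradB (P := P) (Q := Q) A c α β)
  obtain ⟨KC, hKC, hGC⟩ := exists_inBox_of_inBox ρ (continuous_gradC (P := P) (Q := Q) A c α β)
  obtain ⟨KS, hKS, hGS⟩ := exists_inBox_of_inBox ρ (continuous_gradS (P := P) (Q := Q) A c α β)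
  obtain ⟨LB, hLB, hJB⟩ := exists_J_le_B (P := P) (Q := Q) (α := α) A hc hβ ρ
  obtain ⟨LC, hLC, hJC⟩ := exists_J_le_C (P := P) (Q := Q) (β := β) A hc hα ρ
  obtain ⟨LS, hLS, hJS⟩ := exists_J_le_S (P := P) (Q := Q) (c := c) (α := α) (β := β) A ρ
  -- All summands are nonnegative, so the sum dominates each of them: the `K` terms serve
  -- nonnegativity, the `L` terms descent.
  refine ⟨KB + KC + KS + 2 * LB * ρ + 2 * LC * ρ + 2 * LS * ρ, by positivity, ?_⟩
  set δ₀ := KB + KC + KS + 2 * LB * ρ + 2 * LC * ρ + 2 * LS * ρ with hδ₀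
  have hLBρ : 0 ≤ 2 * LB * ρ := by positivity
  have hLCρ : 0 ≤ 2 * LC * ρ := by positivity
  have hLSρ : 0 ≤ 2 * LS * ρ := by positivity
  have hδ₀pos : 0 < δ₀ := by linarith
  rintro δB δC δS hδB hδC hδS ⟨TB, hTB⟩ ⟨TC, hTC⟩ ⟨TS, hTS⟩ B S C hseq hBR hSR hCR B' S' C' hcl
  have hB : ∀ k, InBox ρ (B k) := fun k i j => (hBR k i j).trans (le_max_left _ _)
  have hS : ∀ k, InBox ρ (S k) := fun k i j => (hSR k i j).trans (le_max_left _ _)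
  have hC : ∀ k, InBox ρ (C k) := fun k i j => (hCR k i j).trans (le_max_left _ _)
  obtain ⟨GB, GB_eq⟩ : ∃ F : ℕ → Matrix (Fin M) (Fin P) ℝ, ∀ k, F k =
      gradB A c α β (B k) (S k) (C k) := ⟨_, fun _ => rfl⟩
  obtain ⟨GC, GC_eq⟩ : ∃ F : ℕ → Matrix (Fin Q) (Fin N) ℝ, ∀ k, F k =
      gradC A c α β (B (k + 1)) (S k) (C k) := ⟨_, fun _ => rfl⟩
  obtain ⟨GS, GS_eq⟩ : ∃ F : ℕ → Matrix (Fin P) (Fin Q) ℝ, ∀ k, F k =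
      gradS A c α β (B (k + 1)) (S k) (C (k + 1)) := ⟨_, fun _ => rfl⟩
  obtain ⟨DB, DB_eq⟩ : ∃ F : ℕ → Matrix (Fin M) (Fin P) ℝ, ∀ k, F k =
      denomB β (bar σ (B k) (GB k)) (S k) (C k) := ⟨_, fun _ => rfl⟩
  obtain ⟨DC, DC_eq⟩ : ∃ F : ℕ → Matrix (Fin Q) (Fin N) ℝ, ∀ k, F k =
      denomC α (B (k + 1)) (S k) (bar σ (C k) (GC k)) := ⟨_, fun _ => rfl⟩
  obtain ⟨DS, DS_eq⟩ : ∃ F : ℕ → Matrix (Fin P) (Fin Q) ℝ, ∀ k, F k =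
      denomS (B (k + 1)) (bar σ (S k) (GS k)) (C (k + 1)) := ⟨_, fun _ => rfl⟩
  have stepB : ∀ k, B (k + 1) = step σ (δB k) (B k) (GB k) (DB k) := fun k => by
    rw [hseq.step_B, DB_eq, GB_eq]; rfl
  have stepC : ∀ k, C (k + 1) = step σ (δC k) (C k) (GC k) (DC k) := fun k => by
    rw [hseq.step_C, DC_eq, GC_eq]; rfl
  have stepS : ∀ k, S (k + 1) = step σ (δS k) (S k) (GS k) (DS k) := fun k => by
    rw [hseq.step_S, DS_eq, GS_eq]; rfl
  have boxGB : ∀ k, InBox (δB k) (GB k) := fun k i j => GB_eq k ▸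
    (hGB _ _ _ (hB k) (hS k) (hC k) i j).trans (by linarith [hδB k])
  have boxGC : ∀ k, InBox (δC k) (GC k) := fun k i j => GC_eq k ▸
    (hGC _ _ _ (hB (k + 1)) (hS k) (hC k) i j).trans (by linarith [hδC k])
  have boxGS : ∀ k, InBox (δS k) (GS k) := fun k i j => GS_eq k ▸
    (hGS _ _ _ (hB (k + 1)) (hS k) (hC (k + 1)) i j).trans (by linarith [hδS k])
  have succB : ∀ k, BNMtF.Nonneg (B k) → BNMtF.Nonneg (S k) → BNMtF.Nonneg (C k) →
      BNMtF.Nonneg (B (k + 1)) := fun k hb hs hc' => by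
    rw [stepB]
    exact step_nonneg hb (DB_eq k ▸ (bar_nonneg hb).denomB hβ hs hc') (hδ₀pos.trans_le (hδB k)) (boxGB k)
  have succC : ∀ k, BNMtF.Nonneg (B (k + 1)) → BNMtF.Nonneg (S k) → BNMtF.Nonneg (C k) →
      BNMtF.Nonneg (C (k + 1)) := fun k hb hs hc' => by
    rw [stepC]
    exact step_nonneg hc' (DC_eq k ▸ hb.denomC hα hs (bar_nonneg hc')) (hδ₀pos.trans_le (hδC k)) (boxGC k)
  have succS : ∀ k, BNMtF.Nonneg (B (k + 1)) → BNMtF.Nonneg (S k) → BNMtF.Nonneg (C (k + 1)) →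
      BNMtF.Nonneg (S (k + 1)) := fun k hb hs hc' => by
    rw [stepS]
    exact step_nonneg hs (DS_eq k ▸ hb.denomS (bar_nonneg hs) hc') (hδ₀pos.trans_le (hδS k)) (boxGS k)
  -- The blocks are treated in the order of the algorithm, because each denominator contains the
  -- factors already updated.
  have hnonneg : ∀ k, BNMtF.Nonneg (B k) ∧ BNMtF.Nonneg (S k) ∧ BNMtF.Nonneg (C k) := by
    intro k
    induction k with
    | zero => exact ⟨hseq.init_B, hseq.init_S, hseq.init_C⟩
    | succ k ih =>
      obtain ⟨hb, hs, hc'⟩ := ih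
      have hb' := succB k hb hs hc'
      have hc'' := succC k hb' hs hc'
      exact ⟨hb', succS k hb' hs hc'', hc''⟩
  have nB : ∀ k, BNMtF.Nonneg (B k) := fun k => (hnonneg k).1
  have nS : ∀ k, BNMtF.Nonneg (S k) := fun k => (hnonneg k).2.1
  have nC : ∀ k, BNMtF.Nonneg (C k) := fun k => (hnonneg k).2.2
  have nDB : ∀ k, BNMtF.Nonneg (DB k) := fun k => DB_eq k ▸ (bar_nonneg (nB k)).denomB hβ (nS k) (nC k)
  have nDC : ∀ k, BNMtF.Nonneg (DC k) := fun k => DC_eq k ▸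
    (nB (k + 1)).denomC hα (nS k) (bar_nonneg (nC k))
  have nDS : ∀ k, BNMtF.Nonneg (DS k) := fun k => DS_eq k ▸
    (nB (k + 1)).denomS (bar_nonneg (nS k)) (nC (k + 1))
  have barB : ∀ k, InBox ρ (bar σ (B k) (GB k)) := fun k => bar_inBox hσ hσρ (hB k)
  have barC : ∀ k, InBox ρ (bar σ (C k) (GC k)) := fun k => bar_inBox hσ hσρ (hC k)
  have barS : ∀ k, InBox ρ (bar σ (S k) (GS k)) := fun k => bar_inBox hσ hσρ (hS k)
  obtain ⟨HB, hHB, hDB⟩ := exists_inBox_of_inBox (a := M) (b := P) (a' := P) (b' := Q)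
    (a'' := Q) (b'' := N) ρ (F := fun x => denomB β x.1 x.2.1 x.2.2) (by unfold denomB; fun_prop)
  obtain ⟨HC, hHC, hDC⟩ := exists_inBox_of_inBox (a := M) (b := P) (a' := P) (b' := Q)
    (a'' := Q) (b'' := N) ρ (F := fun x => denomC α x.1 x.2.1 x.2.2) (by unfold denomC; fun_prop)
  obtain ⟨HS, hHS, hDS⟩ := exists_inBox_of_inBox (a := M) (b := P) (a' := P) (b' := Q)
    (a'' := Q) (b'' := N) ρ (F := fun x => denomS x.1 x.2.1 x.2.2) (by unfold denomS; fun_prop)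
  -- Boundedness of the `δ` sequences is needed only here: it caps the denominators, so the decrease
  -- per unit of energy does not degenerate.
  have hTB' : ∀ k, δB k ≤ TB := fun k => hTB ⟨k, rfl⟩
  have hTC' : ∀ k, δC k ≤ TC := fun k => hTC ⟨k, rfl⟩
  have hTS' : ∀ k, δS k ≤ TS := fun k => hTS ⟨k, rfl⟩
  have descB : ∀ k, J A c α β (B (k + 1)) (S k) (C k) ≤ J A c α β (B k) (S k) (C k) -
      energy σ (B k) (GB k) / (2 * (HB + TB)) := fun k => by
    refine step_descent (nB k) (nDB k) (hδ₀pos.trans_le (hδB k)) hLB (barB k)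
      (by linarith [hδB k]) (fun i j => add_le_add (DB_eq k ▸ (le_abs_self _).trans
        (hDB _ _ _ (barB k) (hS k) (hC k) i j)) (hTB' k)) ?_
    rw [← stepB, GB_eq]
    exact hJB _ _ _ _ (hB k) (hB (k + 1)) (hS k) (hC k)
  have descC : ∀ k, J A c α β (B (k + 1)) (S k) (C (k + 1)) ≤ J A c α β (B (k + 1)) (S k) (C k) -
      energy σ (C k) (GC k) / (2 * (HC + TC)) := fun k => by
    refine step_descent (nC k) (nDC k) (hδ₀pos.trans_le (hδC k)) hLC (barC k)
      (by linarith [hδC k]) (fun i j => add_le_add (DC_eq k ▸ (le_abs_self _).trans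
        (hDC _ _ _ (hB (k + 1)) (hS k) (barC k) i j)) (hTC' k)) ?_
    rw [← stepC, GC_eq]
    exact hJC _ _ _ _ (hB (k + 1)) (hS k) (hC k) (hC (k + 1))
  have descS : ∀ k, J A c α β (B (k + 1)) (S (k + 1)) (C (k + 1)) ≤
      J A c α β (B (k + 1)) (S k) (C (k + 1)) -
      energy σ (S k) (GS k) / (2 * (HS + TS)) := fun k => by
    refine step_descent (nS k) (nDS k) (hδ₀pos.trans_le (hδS k)) hLS (barS k)
      (by linarith [hδS k]) (fun i j => add_le_add (DS_eq k ▸ (le_abs_self _).trans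
        (hDS _ _ _ (hB (k + 1)) (barS k) (hC (k + 1)) i j)) (hTS' k)) ?_
    rw [← stepS, GS_eq]
    exact hJS _ _ _ _ (hB (k + 1)) (hS k) (hS (k + 1)) (hC (k + 1))
  have pTB : 0 < 2 * (HB + TB) := by linarith [hTB' 0, hδB 0]
  have pTC : 0 < 2 * (HC + TC) := by linarith [hTC' 0, hδC 0]
  have pTS : 0 < 2 * (HS + TS) := by linarith [hTS' 0, hδS 0]
  have eB : ∀ k, 0 ≤ energy σ (B k) (GB k) / (2 * (HB + TB)) := fun k =>
    div_nonneg (energy_nonneg (nB k)) pTB.le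
  have eC : ∀ k, 0 ≤ energy σ (C k) (GC k) / (2 * (HC + TC)) := fun k =>
    div_nonneg (energy_nonneg (nC k)) pTC.le
  have eS : ∀ k, 0 ≤ energy σ (S k) (GS k) / (2 * (HS + TS)) := fun k =>
    div_nonneg (energy_nonneg (nS k)) pTS.le
  have hsum := tendsto_zero_of_le_sub (a := fun k => J A c α β (B k) (S k) (C k))
    (d := fun k => energy σ (B k) (GB k) / (2 * (HB + TB)) +
      energy σ (C k) (GC k) / (2 * (HC + TC)) + energy σ (S k) (GS k) / (2 * (HS + TS)))
    (fun k => J_nonneg A hc hα hβ _ _ _) (fun k => add_nonneg (add_nonneg (eB k) (eC k)) (eS k))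
    (fun k => by linarith [descB k, descC k, descS k])
  have limEB : Tendsto (fun k => energy σ (B k) (GB k)) atTop (𝓝 0) := by
    have := (squeeze_zero eB (fun k => by linarith [eC k, eS k]) hsum).mul_const (2 * (HB + TB))
    simpa [div_mul_cancel₀ _ pTB.ne'] using this
  have limEC : Tendsto (fun k => energy σ (C k) (GC k)) atTop (𝓝 0) := by
    have := (squeeze_zero eC (fun k => by linarith [eB k, eS k]) hsum).mul_const (2 * (HC + TC))
    simpa [div_mul_cancel₀ _ pTC.ne'] using this
  have limES : Tendsto (fun k => energy σ (S k) (GS k)) atTop (𝓝 0) := by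
    have := (squeeze_zero eS (fun k => by linarith [eB k, eC k]) hsum).mul_const (2 * (HS + TS))
    simpa [div_mul_cancel₀ _ pTS.ne'] using this
  -- An ultrafilter finer than `atTop` plays the role of a convergent subsequence.
  obtain ⟨U, hU, hlim⟩ := mapClusterPt_iff_ultrafilter.1 hcl
  have limB : Tendsto B U (𝓝 B') := (continuous_fst.tendsto _).comp hlim
  have limS : Tendsto S U (𝓝 S') := ((continuous_fst.comp continuous_snd).tendsto _).comp hlim
  have limC : Tendsto C U (𝓝 C') := ((continuous_snd.comp continuous_snd).tendsto _).comp hlim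
  -- Convergence along `U` says nothing by itself about shifted indices; vanishing energy supplies
  -- it. The gradients for `C` and `S` use the shifted `B`, and that for `S` also the shifted `C`.
  have limB1 : Tendsto (fun k => B (k + 1)) U (𝓝 B') := by
    simp only [stepB]
    exact tendsto_step nB nDB hδ₀pos hδB barB (limEB.mono_left hU) limB
  have limC1 : Tendsto (fun k => C (k + 1)) U (𝓝 C') := by
    simp only [stepC]
    exact tendsto_step nC nDC hδ₀pos hδC barC (limEC.mono_left hU) limC
  have limGB : Tendsto GB U (𝓝 (gradB A c α β B' S' C')) :=
    (tendsto_congr GB_eq).2 (tendsto_of_continuous_triple (continuous_gradB A c α β) limB limS limC)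
  have limGC : Tendsto GC U (𝓝 (gradC A c α β B' S' C')) :=
    (tendsto_congr GC_eq).2 (tendsto_of_continuous_triple (continuous_gradC A c α β) limB1 limS limC)
  have limGS : Tendsto GS U (𝓝 (gradS A c α β B' S' C')) :=
    (tendsto_congr GS_eq).2 (tendsto_of_continuous_triple (continuous_gradS A c α β) limB1 limS limC1)
  obtain ⟨b1, b2, b3⟩ := complementarity_of_tendsto hσ nB (limEB.mono_left hU) limB limGB
  obtain ⟨c1, c2, c3⟩ := complementarity_of_tendsto hσ nC (limEC.mono_left hU) limC limGC
  obtain ⟨s1, s2, s3⟩ := complementarity_of_tendsto hσ nS (limES.mono_left hU) limS limGS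
  exact ⟨b1, s1, c1, b2, s2, c2, b3, s3, c3⟩
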